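/- Let $m,n\ge 1$, $r=\min(m,n)$, and let $A\in\mathbb{R}^{m\times n}$ have full rank $r$, with thin SVD $A=U\Sigma V^T$, where $U\in\mathbb{R}^{m\times r}$, $V\in\mathbb{R}^{n\times r}$, $U^TU=V^TV=I$, $\Sigma=\mathrm{diag}(\sigma_1,\dots,\sigma_r)$ and $\sigma_{\max}=\sigma_1\ge\dots\ge\sigma_r=\sigma_{\min}>0$. For a real matrix $X$ let $X^+$ be its Moore–Penrose pseudoinverse, $\|X\|_2$ its operator 2-norm, and $\kappa_2(X)=\|X^+\|_2\|X\|_2$. Let $e_i\in\mathbb{R}^r$ be the $i$-th unit vector, and put $B=\|A^+\|_2\,Ve_1e_1^TU^T$, $C=\|A\|_2\,Ue_re_r^TV^T$ and $$G=B^T-(A^+CA^+)^T+(A^+)^TA^+C(I-A^+A)+(I-AA^+)CA^+(A^+)^T .$$ (1) If $\kappa_2$ is differentiable at $A$, then its derivative with respect to the matrix is $\frac{\partial(\|A^+\|_2\|A\|_2)}{\partial A}=G$, that is, $d\kappa_2=\mathrm{tr}(G^T\,dA)$. If $\sigma_1>\sigma_i$ for all $i\ne 1$ and $\sigma_r<\sigma_i$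 for all $i\neq r$, then $\kappa_2$ is differentiable at $A$, with this derivative. (2) Let $A=A(\theta)$ depend on an array $\theta=(\theta_{i,j})$ of real parameters, and let the partial derivative $\frac{\partial A}{\partial\theta_{i,j}}$ exist at the given $\theta$. If $\frac{\partial\kappa_2(A)}{\partial\theta_{i,j}}$ exists there, then $$\frac{\partial\kappa_2(A)}{\partial\theta_{i,j}}=\mathrm{tr}\Big(G^T\,\frac{\partial A}{\partial\theta_{i,j}}\Big),$$ and it does exist if $\sigma_1>\sigma_i$ for all $i\neq 1$ and $\sigma_r<\sigma_i$ for all $i\ne r$. -/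

import Mathlib

open scoped Matrix Matrix.Norms.L2Operator

/-- `X` is a Moore-Penrose pseudoinverse of the real matrix `A` (the four Penrose conditions). -/
structure IsMoorePenrose {m n : ℕ} (A : Matrix (Fin m) (Fin n) ℝ)
    (X : Matrix (Fin n) (Fin m) ℝ) : Prop where
  mul_mul_self : A * X * A = A
  self_mul_mul : X * A * X = X
  symm_left : (A * X)ᵀ = A * X
  symm_right : (X * A)ᵀ = X * A

theorem IsMoorePenrose.unique {m n : ℕ} {A : Matrix (Fin m) (Fin n) ℝ}
    {X Y : Matrix (Fin n) (Fin m) ℝ} (hX : IsMoorePenrose A X) (hY : IsMoorePenrose A Y) :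
    X = Y := by
  have h1 : A * X = A * Y := by
    calc A * X = (A * X)ᵀ := hX.symm_left.symm
      _ = ((A * Y) * (A * X))ᵀ := by
          rw [← Matrix.mul_assoc (A * Y) A X, hY.mul_mul_self]
      _ = (A * X) * (A * Y) := by rw [Matrix.transpose_mul, hX.symm_left, hY.symm_left]
      _ = A * Y := by rw [← Matrix.mul_assoc (A * X) A Y, hX.mul_mul_self]
  have h2 : X * A = Y * A := by
    calc X * A = (X * A)ᵀ := hX.symm_right.symm
      _ = ((X * A) * (Y * A))ᵀ := by
          rw [Matrix.mul_assoc X A (Y * A), ← Matrix.mul_assoc A Y A, hY.mul_mul_self]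
      _ = (Y * A) * (X * A) := by rw [Matrix.transpose_mul, hX.symm_right, hY.symm_right]
      _ = Y * A := by
          rw [Matrix.mul_assoc Y A (X * A), ← Matrix.mul_assoc A X A, hX.mul_mul_self]
  calc X = X * A * X := hX.self_mul_mul.symm
    _ = Y * A * Y := by rw [h2, Matrix.mul_assoc, h1, ← Matrix.mul_assoc]
    _ = Y := hY.self_mul_mul

/-- Every real matrix has a Moore-Penrose pseudoinverse. -/
theorem exists_isMoorePenrose {m n : ℕ} (A : Matrix (Fin m) (Fin n) ℝ) :
    ∃ X, IsMoorePenrose A X := by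
  have hS : (Aᵀ * A).IsHermitian := by
    simpa [Matrix.conjTranspose_eq_transpose_of_trivial] using
      Matrix.isHermitian_conjTranspose_mul_self A
  obtain ⟨W, d, hW, hdec⟩ : ∃ (W : Matrix (Fin n) (Fin n) ℝ) (d : Fin n → ℝ),
      Wᵀ * W = 1 ∧ Aᵀ * A = W * Matrix.diagonal d * Wᵀ := by
    refine ⟨hS.eigenvectorUnitary, hS.eigenvalues, ?_, ?_⟩
    · have := (Matrix.mem_unitaryGroup_iff').1 hS.eigenvectorUnitary.2
      simpa [Matrix.star_eq_conjTranspose, Matrix.conjTranspose_eq_transpose_of_trivial] using this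
    · have := hS.spectral_theorem
      simpa [Unitary.conjStarAlgAut_apply, Matrix.star_eq_conjTranspose,
        Matrix.conjTranspose_eq_transpose_of_trivial, Function.comp_def] using this
  have key : ∀ a b : Fin n → ℝ, (W * Matrix.diagonal a * Wᵀ) * (W * Matrix.diagonal b * Wᵀ)
      = W * Matrix.diagonal (fun i => a i * b i) * Wᵀ := by
    intro a b
    calc _ = W * Matrix.diagonal a * (Wᵀ * W) * Matrix.diagonal b * Wᵀ := by
          simp only [Matrix.mul_assoc]
      _ = _ := by rw [hW, Matrix.mul_one, Matrix.mul_assoc W, Matrix.diagonal_mul_diagonal]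
  have ksymm : ∀ a : Fin n → ℝ,
      (W * Matrix.diagonal a * Wᵀ)ᵀ = W * Matrix.diagonal a * Wᵀ := by
    intro a
    simp [Matrix.transpose_mul, Matrix.mul_assoc]
  set S := Aᵀ * A with hSdef
  obtain ⟨T, hT⟩ : ∃ T, T = W * Matrix.diagonal (fun i => (d i)⁻¹) * Wᵀ := ⟨_, rfl⟩
  have hTt : Tᵀ = T := by rw [hT, ksymm]
  have hSt : Sᵀ = S := by rw [hdec, ksymm]
  have hTSt : (T * S)ᵀ = T * S := by rw [hT, hdec, key, ksymm]
  have hTST : T * S * T = T := by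
    rw [hT, hdec, key, key]
    congr 3
    funext i
    by_cases h : d i = 0 <;> simp [h]
  have hSTS : S * (T * S) = S := by
    rw [hT, hdec, key, key]
    congr 3
    funext i
    by_cases h : d i = 0 <;> simp [h]
  refine ⟨T * Aᵀ, ?_, ?_, ?_, ?_⟩
  · have hz : (A * (T * S) - A)ᵀ * (A * (T * S) - A) = 0 := by
      have : (A * (T * S) - A)ᵀ = (T * S) * Aᵀ - Aᵀ := by
        rw [Matrix.transpose_sub, Matrix.transpose_mul, hTSt]
      rw [this, Matrix.sub_mul, Matrix.mul_sub, Matrix.mul_sub]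
      have e1 : Aᵀ * (A * (T * S)) = S := by rw [← Matrix.mul_assoc, ← hSdef, hSTS]
      have e2 : T * S * Aᵀ * (A * (T * S)) = T * S * S := by rw [Matrix.mul_assoc (T * S), e1]
      have e3 : T * S * Aᵀ * A = T * S * S := by rw [Matrix.mul_assoc (T * S)]
      rw [e1, e2, e3, ← hSdef]
      simp
    have h0 : A * (T * S) - A = 0 := by
      rw [← Matrix.conjTranspose_eq_transpose_of_trivial] at hz
      exact Matrix.conjTranspose_mul_self_eq_zero.1 hz
    calc A * (T * Aᵀ) * A = A * (T * S) := by simp only [hSdef, Matrix.mul_assoc]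
      _ = A := sub_eq_zero.1 h0
  · calc T * Aᵀ * A * (T * Aᵀ) = (T * S * T) * Aᵀ := by simp only [hSdef, Matrix.mul_assoc]
      _ = T * Aᵀ := by rw [hTST]
  · simp only [Matrix.transpose_mul, Matrix.transpose_transpose, hTt, Matrix.mul_assoc]
  · rw [Matrix.mul_assoc, ← hSdef, hTSt]

/-- The pseudoinverse `A⁺` of a real matrix: the unique matrix satisfying the Penrose conditions. -/
noncomputable def pinv {m n : ℕ} (A : Matrix (Fin m) (Fin n) ℝ) : Matrix (Fin n) (Fin m) ℝ :=
  Classical.choose (exists_isMoorePenrose A)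

theorem pinv_spec {m n : ℕ} (A : Matrix (Fin m) (Fin n) ℝ) : IsMoorePenrose A (pinv A) :=
  Classical.choose_spec (exists_isMoorePenrose A)

/-- `κ₂(A) = ‖A⁺‖₂ ‖A‖₂`; the norm is the 2-operator norm (`Matrix.Norms.L2Operator`). -/
noncomputable def cond2 {m n : ℕ} (A : Matrix (Fin m) (Fin n) ℝ) : ℝ :=
  ‖pinv A‖ * ‖A‖

/-- `A = U Σ Vᵀ` with `UᵀU = I = VᵀV` and `Σ = diag(σ)`, `σ ≥ 0`, of size `r × r`. -/
structure IsThinSVD {m n r : ℕ} (A : Matrix (Fin m) (Fin n) ℝ) (U : Matrix (Fin m) (Fin r) ℝ)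
    (σ : Fin r → ℝ) (V : Matrix (Fin n) (Fin r) ℝ) : Prop where
  orthU : Uᵀ * U = 1
  orthV : Vᵀ * V = 1
  nonneg : ∀ i, 0 ≤ σ i
  eq : A = U * Matrix.diagonal σ * Vᵀ

/-- The matrix `e_i e_iᵀ`, where `e_i` is the `i`-th standard unit vector. -/
def unitOuter {r : ℕ} (i : Fin r) : Matrix (Fin r) (Fin r) ℝ :=
  Matrix.vecMulVec (Pi.single i 1) (Pi.single i 1)

/-- The linear functional `H ↦ tr(Gᵀ H)` on `m × n` matrices. -/
noncomputable def traceDual {m n : ℕ} (G : Matrix (Fin m) (Fin n) ℝ) :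
    Matrix (Fin m) (Fin n) ℝ →L[ℝ] ℝ :=
  LinearMap.toContinuousLinearMap
    { toFun := fun H => (Gᵀ * H).trace
      map_add' := fun H K => by rw [Matrix.mul_add, Matrix.trace_add]
      map_smul' := fun c H => by
        rw [Matrix.mul_smul, Matrix.trace_smul, RingHom.id_apply] }

/-- `∂f/∂A = G` at `A`: `f` is (Fréchet) differentiable at `A` with `df = tr(Gᵀ dA)`,
so that the `(i, j)` entry of `G` is the partial derivative of `f` in the `(i, j)` entry. -/
def HasMatrixDerivAt {m n : ℕ} (f : Matrix (Fin m) (Fin n) ℝ → ℝ)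
    (G A : Matrix (Fin m) (Fin n) ℝ) : Prop :=
  HasFDerivAt f (traceDual G) A

/-!
The condition number is `κ₂ = σ₁ / σᵣ`, and the matrix `G` collapses to the expected gradient
`u₁ v₁ᵀ / σᵣ - (σ₁ / σᵣ²) uᵣ vᵣᵀ` (`IsThinSVD.eq_quotientGradient`), since `A⁺ = V Σ⁻¹ Uᵀ` and
the terms with the projections `1 - A⁺ A` and `1 - A A⁺` vanish.

No perturbation theory of singular vectors is needed: it is enough to touch `κ₂` at `A` by
differentiable functions with this gradient. Suppose that `A` has full column rank; the other case
follows by transposition.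

* From below, with no assumption on the singular values, `‖X‖ ≥ ‖X v₁‖` and
  `‖X⁺‖ ≥ 1 / ‖X vᵣ‖` give `κ₂(X) ≥ ‖X v₁‖ / ‖X vᵣ‖` near `A`, with equality at `A`
  (`IsThinSVD.hasSubderivAt_of_tall`). So if `κ₂` is differentiable at `A`, or if its restriction
  to a curve through `A` is differentiable, the derivative is the one of this quotient: the
  difference has a local minimum (`HasSubderivAt.hasFDerivAt`).
* From above, if `σ₁` and `σᵣ` are simple, then for a unit vector `x` the quantity `‖X x‖²` exceeds
  `‖X v₁‖²` by at most a multiple of `‖X - A‖²`: moving `x` away from `v₁` costs a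
  multiple `δ` of the squared distance `b²`, while the perturbation gains at most a multiple of
  `‖X - A‖ b` (`abs_norm_sq_sub_le`). The same holds at `vᵣ` with the inequalities reversed. Hence
  the quotient above, with quadratic corrections that do not change its derivative, dominates `κ₂`
  (`IsThinSVD.hasSuperderivAt_of_tall`), and `κ₂` is squeezed between two functions with the same
  derivative (`HasSubderivAt.hasFDerivAt_of_superderiv`).
-/

open Filter Topology Asymptotics
open scoped RealInnerProductSpace

/-! ### Touching a function by differentiable minorants and majorants -/

section Contact

variable {E F : Type*} [NormedAddCommGroup E] [NormedSpace ℝ E]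
  [NormedAddCommGroup F] [NormedSpace ℝ F]

/-- `f'` is a subderivative of `f` at `a`: near `a`, the function `f` dominates a function that
agrees with it at `a` and has Fréchet derivative `f'` there. -/
def HasSubderivAt (f : E → ℝ) (f' : E →L[ℝ] ℝ) (a : E) : Prop :=
  ∃ g : E → ℝ, HasFDerivAt g f' a ∧ g a = f a ∧ ∀ᶠ x in 𝓝 a, g x ≤ f x

/-- `f'` is a superderivative of `f` at `a`: near `a`, the function `f` is dominated by a function
that agrees with it at `a` and has Fréchet derivative `f'` there. -/
def HasSuperderivAt (f : E → ℝ) (f' : E →L[ℝ] ℝ) (a : E) : Prop :=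
  ∃ g : E → ℝ, HasFDerivAt g f' a ∧ g a = f a ∧ ∀ᶠ x in 𝓝 a, f x ≤ g x

theorem HasSubderivAt.comp_hasFDerivAt {f : E → ℝ} {f' : E →L[ℝ] ℝ} {c : F → E} {c' : F →L[ℝ] E}
    {t : F} (hf : HasSubderivAt f f' (c t)) (hc : HasFDerivAt c c' t) :
    HasSubderivAt (fun s => f (c s)) (f'.comp c') t := by
  obtain ⟨g, hg, hga, hle⟩ := hf
  exact ⟨fun s => g (c s), hg.comp t hc, hga, hc.continuousAt.eventually hle⟩

theorem HasSuperderivAt.comp_hasFDerivAt {f : E → ℝ} {f' : E →L[ℝ] ℝ} {c : F → E}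
    {c' : F →L[ℝ] E} {t : F} (hf : HasSuperderivAt f f' (c t)) (hc : HasFDerivAt c c' t) :
    HasSuperderivAt (fun s => f (c s)) (f'.comp c') t := by
  obtain ⟨g, hg, hga, hle⟩ := hf
  exact ⟨fun s => g (c s), hg.comp t hc, hga, hc.continuousAt.eventually hle⟩

/-- The derivative of a differentiable function is its only subderivative, because the difference
of the function and the touching minorant has a local minimum. -/
theorem HasSubderivAt.hasFDerivAt {f : E → ℝ} {f' : E →L[ℝ] ℝ} {a : E}
    (hf : HasSubderivAt f f' a) (hd : DifferentiableAt ℝ f a) : HasFDerivAt f f' a := by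
  obtain ⟨g, hg, hga, hle⟩ := hf
  have hmin : IsLocalMin (f - g) a := by
    filter_upwards [hle] with x hx
    simp only [Pi.sub_apply, hga, sub_self]
    exact sub_nonneg.2 hx
  have h0 := hmin.hasFDerivAt_eq_zero (hd.hasFDerivAt.sub hg)
  rw [← sub_eq_zero.1 h0]
  exact hd.hasFDerivAt

theorem HasSubderivAt.hasFDerivAt_of_superderiv {f : E → ℝ} {f' : E →L[ℝ] ℝ} {a : E}
    (hf : HasSubderivAt f f' a) (hf' : HasSuperderivAt f f' a) : HasFDerivAt f f' a := by
  obtain ⟨g, hg, hga, hle⟩ := hf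
  obtain ⟨k, hk, hka, hle'⟩ := hf'
  rw [hasFDerivAt_iff_isLittleO] at hg hk ⊢
  refine IsBigO.trans_isLittleO ?_ (hg.norm_left.add hk.norm_left)
  refine IsBigO.of_bound 1 ?_
  filter_upwards [hle, hle'] with x hx hx'
  rw [one_mul, Real.norm_eq_abs, Real.norm_of_nonneg (by positivity), Real.norm_eq_abs,
    Real.norm_eq_abs, hga, hka, abs_le]
  -- the remainder of `f` lies between the remainders of the two touching functions
  have h1 := neg_abs_le (g x - f a - f' (x - a))
  have h2 := le_abs_self (k x - f a - f' (x - a))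
  have h3 := abs_nonneg (g x - f a - f' (x - a))
  have h4 := abs_nonneg (k x - f a - f' (x - a))
  constructor <;> linarith

end Contact

/-! ### Perturbation of simple extreme singular values -/

section Perturbation

variable {E F : Type*} [NormedAddCommGroup E] [InnerProductSpace ℝ E]
  [NormedAddCommGroup F] [InnerProductSpace ℝ F]

/-- A quadratic form `⟪T x, x⟫` differs from `‖x‖² ⟪T v, v⟫` by at most a multiple of the distance
from `x` to the line spanned by the unit vector `v`. -/
theorem abs_inner_apply_sub_le (T : E →L[ℝ] E) {v : E} (hv : ‖v‖ = 1) (x : E) {b : ℝ}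
    (hb : 0 ≤ b) (hbx : b ^ 2 = ‖x‖ ^ 2 - ⟪v, x⟫ ^ 2) :
    |⟪T x, x⟫ - ‖x‖ ^ 2 * ⟪T v, v⟫| ≤ 4 * ‖T‖ * ‖x‖ * b := by
  set c := ⟪v, x⟫ with hc
  set w := x - c • v with hw
  have hwb : ‖w‖ = b := by
    have : ‖w‖ ^ 2 = b ^ 2 := by
      rw [hbx, hw, norm_sub_sq_real, inner_smul_right, real_inner_comm, ← hc, norm_smul, hv,
        Real.norm_eq_abs, mul_one, sq_abs]
      ring
    exact (sq_eq_sq₀ (norm_nonneg _) hb).1 this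
  have hx : x = c • v + w := by simp [hw]
  have hT : ∀ y z : E, |⟪T y, z⟫| ≤ ‖T‖ * ‖y‖ * ‖z‖ := fun y z =>
    (abs_real_inner_le_norm _ _).trans
      (mul_le_mul_of_nonneg_right (T.le_opNorm y) (norm_nonneg _))
  have hcx : |c| ≤ ‖x‖ := by
    have := abs_real_inner_le_norm v x
    rwa [hv, one_mul] at this
  have hbx' : b ≤ ‖x‖ := by
    refine (sq_le_sq₀ hb (norm_nonneg _)).1 ?_
    rw [hbx]; nlinarith [sq_nonneg c]
  have hexp : ⟪T x, x⟫ - ‖x‖ ^ 2 * ⟪T v, v⟫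
      = c * ⟪T v, w⟫ + c * ⟪T w, v⟫ + ⟪T w, w⟫ - b ^ 2 * ⟪T v, v⟫ := by
    have e : ⟪T x, x⟫ = c ^ 2 * ⟪T v, v⟫ + c * ⟪T v, w⟫ + c * ⟪T w, v⟫ + ⟪T w, w⟫ := by
      conv_lhs => rw [hx]
      simp only [map_add, map_smul, inner_add_left, inner_add_right, real_inner_smul_left,
        real_inner_smul_right]
      ring
    rw [e, hbx]; ring
  have h1 := hT v w
  have h2 := hT w v
  have h3 := hT w w
  have h4 := hT v v
  rw [hwb] at h1 h2 h3
  rw [hv] at h1 h2 h4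
  have hTn := norm_nonneg T
  have h5 : |c * ⟪T v, w⟫| ≤ ‖x‖ * (‖T‖ * 1 * b) := by
    rw [abs_mul]; gcongr
  have h6 : |c * ⟪T w, v⟫| ≤ ‖x‖ * (‖T‖ * b * 1) := by
    rw [abs_mul]; gcongr
  have h7 : |⟪T w, w⟫| ≤ ‖T‖ * b * ‖x‖ := h3.trans (by gcongr)
  have h8 : |b ^ 2 * ⟪T v, v⟫| ≤ b * ‖x‖ * (‖T‖ * 1 * 1) := by
    rw [abs_mul, abs_of_nonneg (sq_nonneg b), sq]; gcongr
  rw [hexp]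
  rw [abs_le] at h5 h6 h7 h8 ⊢
  constructor <;> linarith

/-- The change of `‖A x‖²` under a perturbation of `A` is, to first order, determined by its value
at a unit vector `v`, up to a term that a spectral gap `δ` at `v` can absorb. -/
theorem abs_norm_sq_sub_le (A X : E →L[ℝ] F) [CompleteSpace E] [CompleteSpace F] {v : E}
    (hv : ‖v‖ = 1) {δ : ℝ} (hδ : 0 < δ) (x : E) :
    |(‖X x‖ ^ 2 - ‖A x‖ ^ 2) - ‖x‖ ^ 2 * (‖X v‖ ^ 2 - ‖A v‖ ^ 2)|
      ≤ δ * (‖x‖ ^ 2 - ⟪v, x⟫ ^ 2)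
        + 4 / δ * ((‖X‖ + ‖A‖) * ‖X - A‖) ^ 2 * ‖x‖ ^ 2 := by
  let T : E →L[ℝ] E := (X.adjoint.comp (X - A)) + ((X - A).adjoint.comp A)
  have hTx : ∀ y, ⟪T y, y⟫ = ‖X y‖ ^ 2 - ‖A y‖ ^ 2 := by
    intro y
    simp only [T, add_apply, ContinuousLinearMap.comp_apply, inner_add_left,
      ContinuousLinearMap.adjoint_inner_left, sub_apply, inner_sub_left,
      inner_sub_right, real_inner_self_eq_norm_sq]
    rw [real_inner_comm (X y) (A y)]; ring
  have hTn : ‖T‖ ≤ (‖X‖ + ‖A‖) * ‖X - A‖ := by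
    calc ‖T‖ ≤ ‖X.adjoint‖ * ‖X - A‖ + ‖(X - A).adjoint‖ * ‖A‖ :=
          (norm_add_le _ _).trans (add_le_add (ContinuousLinearMap.opNorm_comp_le _ _)
            (ContinuousLinearMap.opNorm_comp_le _ _))
      _ = _ := by simp only [LinearIsometryEquiv.norm_map]; ring
  have hnn : 0 ≤ ‖x‖ ^ 2 - ⟪v, x⟫ ^ 2 := by
    have := abs_real_inner_le_norm v x
    rw [hv, one_mul] at this
    have := sq_le_sq' (by linarith [(abs_le.1 this).1]) (abs_le.1 this).2
    linarith
  have h := abs_inner_apply_sub_le T hv x (Real.sqrt_nonneg _) (Real.sq_sqrt hnn)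
  rw [hTx, hTx] at h
  refine h.trans ?_
  have hs := Real.sq_sqrt hnn
  set b := √(‖x‖ ^ 2 - ⟪v, x⟫ ^ 2)
  rw [← hs]
  have hb : 0 ≤ b := Real.sqrt_nonneg _
  set τ := (‖X‖ + ‖A‖) * ‖X - A‖
  have h1 : 4 * ‖T‖ * ‖x‖ * b ≤ 4 * τ * ‖x‖ * b := by gcongr
  -- completing the square, which is where the constant `4 / δ` comes from
  have h2 : δ * b ^ 2 + 4 / δ * τ ^ 2 * ‖x‖ ^ 2 - 4 * τ * ‖x‖ * b
      = (δ * b - 2 * τ * ‖x‖) ^ 2 / δ := by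
    field_simp; ring
  have h3 : 0 ≤ (δ * b - 2 * τ * ‖x‖) ^ 2 / δ := by positivity
  linarith

/-- The quadratic error term of the perturbation bounds has derivative zero at `A`. -/
theorem hasFDerivAt_perturbation_error (A : E →L[ℝ] F) (K : ℝ) :
    HasFDerivAt (fun X : E →L[ℝ] F => K * ((‖X‖ + ‖A‖) * ‖X - A‖) ^ 2)
      (0 : (E →L[ℝ] F) →L[ℝ] ℝ) A := by
  have hc : Continuous fun X : E →L[ℝ] F => K * (‖X‖ + ‖A‖) ^ 2 := by fun_prop
  have h1 := (hc.continuousAt (x := A)).isBigO_one ℝ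
  have h2 : (fun X : E →L[ℝ] F => K * ((‖X‖ + ‖A‖) * ‖X - A‖) ^ 2)
      =O[𝓝 A] fun X => ‖X - A‖ ^ 2 :=
    (h1.mul (isBigO_refl (fun X : E →L[ℝ] F => ‖X - A‖ ^ 2) _)).congr
      (fun X => by ring) (fun X => by ring)
  exact h2.hasFDerivAt (𝕜 := ℝ) one_lt_two

theorem hasFDerivAt_norm_apply_sq (A : E →L[ℝ] F) (v : E) :
    HasFDerivAt (fun X : E →L[ℝ] F => ‖X v‖ ^ 2)
      ((2 : ℝ) • (innerSL ℝ (A v)).comp (ContinuousLinearMap.apply ℝ F v)) A := by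
  have h : HasFDerivAt (fun X : E →L[ℝ] F => X v) (ContinuousLinearMap.apply ℝ F v) A :=
    (ContinuousLinearMap.apply ℝ F v).hasFDerivAt
  refine h.norm_sq.congr_fderiv ?_
  ext H
  simp

/-- The function that touches `X ↦ ‖X‖ / inf_{‖x‖ = 1} ‖X x‖` at `A`, from below for `K = 0` and
from above for large `K` if the singular values are simple, when `A` is injective and `v`, `w` are
singular vectors of `A` for its largest and its smallest singular value. -/
noncomputable def singularQuotient (v w : E) (A : E →L[ℝ] F) (K : ℝ) (X : E →L[ℝ] F) : ℝ :=
  √(‖X v‖ ^ 2 + K * ((‖X‖ + ‖A‖) * ‖X - A‖) ^ 2) /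
    √(‖X w‖ ^ 2 - K * ((‖X‖ + ‖A‖) * ‖X - A‖) ^ 2)

theorem hasFDerivAt_singularQuotient {v w : E} {A : E →L[ℝ] F} (hv : A v ≠ 0) (hw : A w ≠ 0)
    (K : ℝ) :
    HasFDerivAt (singularQuotient v w A K)
      ((‖A v‖ * ‖A w‖)⁻¹ • (innerSL ℝ (A v)).comp (ContinuousLinearMap.apply ℝ F v)
        - (‖A v‖ / ‖A w‖ ^ 3) • (innerSL ℝ (A w)).comp (ContinuousLinearMap.apply ℝ F w)) A := by
  have hv' : ‖A v‖ ≠ 0 := norm_ne_zero_iff.2 hv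
  have hw' : ‖A w‖ ≠ 0 := norm_ne_zero_iff.2 hw
  have e1 : √(‖A v‖ ^ 2 + K * ((‖A‖ + ‖A‖) * ‖A - A‖) ^ 2) = ‖A v‖ := by simp
  have e2 : √(‖A w‖ ^ 2 - K * ((‖A‖ + ‖A‖) * ‖A - A‖) ^ 2) = ‖A w‖ := by simp
  have h1 := ((hasFDerivAt_norm_apply_sq A v).fun_add (hasFDerivAt_perturbation_error A K)).sqrt
    (by simpa using hv)
  have h2 := ((hasFDerivAt_norm_apply_sq A w).fun_sub (hasFDerivAt_perturbation_error A K)).sqrt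
    (by simpa using hw)
  have h3 := h1.mul ((hasDerivAt_inv (x := ‖A w‖) hw').comp_hasFDerivAt_of_eq A h2 e2.symm)
  refine (h3.congr_fderiv ?_).congr_of_eventuallyEq ?_
  · ext H
    simp
    field_simp
    ring
  · filter_upwards with X
    simp [singularQuotient, div_eq_mul_inv]

end Perturbation

/-! ### Matrices as operators between Euclidean spaces -/

section EuclideanCLM

variable {m n r : ℕ}

/-- A real matrix as an operator between Euclidean spaces, as a continuous linear function of the
matrix. -/
noncomputable def euclideanCLM (m n : ℕ) : Matrix (Fin m) (Fin n) ℝ →L[ℝ]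
    (EuclideanSpace ℝ (Fin n) →L[ℝ] EuclideanSpace ℝ (Fin m)) :=
  LinearMap.toContinuousLinearMap
    ((Matrix.toEuclideanLin (𝕜 := ℝ) (m := Fin m) (n := Fin n)).trans
      LinearMap.toContinuousLinearMap).toLinearMap

theorem norm_euclideanCLM (X : Matrix (Fin m) (Fin n) ℝ) : ‖euclideanCLM m n X‖ = ‖X‖ := rfl

theorem euclideanCLM_apply (X : Matrix (Fin m) (Fin n) ℝ) (x : EuclideanSpace ℝ (Fin n)) :
    euclideanCLM m n X x = WithLp.toLp 2 (X *ᵥ x.ofLp) := rfl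

theorem inner_toLp (x y : Fin n → ℝ) :
    ⟪(WithLp.toLp 2 x : EuclideanSpace ℝ (Fin n)), WithLp.toLp 2 y⟫ = x ⬝ᵥ y := by
  rw [EuclideanSpace.inner_eq_star_dotProduct]
  simp [dotProduct_comm]

theorem norm_toLp_sq (x : Fin n → ℝ) :
    ‖(WithLp.toLp 2 x : EuclideanSpace ℝ (Fin n))‖ ^ 2 = x ⬝ᵥ x := by
  rw [← real_inner_self_eq_norm_sq, inner_toLp]

theorem euclideanCLM_mul_apply (X : Matrix (Fin m) (Fin n) ℝ) (Y : Matrix (Fin n) (Fin r) ℝ)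
    (x : EuclideanSpace ℝ (Fin r)) :
    euclideanCLM m r (X * Y) x = euclideanCLM m n X (euclideanCLM n r Y x) := by
  simp [euclideanCLM_apply, Matrix.mulVec_mulVec]

theorem dotProduct_mulVec_of_orth {U : Matrix (Fin m) (Fin r) ℝ} (hU : Uᵀ * U = 1)
    (x y : Fin r → ℝ) : (U *ᵥ x) ⬝ᵥ (U *ᵥ y) = x ⬝ᵥ y := by
  rw [Matrix.dotProduct_mulVec, ← Matrix.mulVec_transpose, Matrix.mulVec_mulVec, hU,
    Matrix.one_mulVec]

theorem norm_transpose (X : Matrix (Fin m) (Fin n) ℝ) : ‖Xᵀ‖ = ‖X‖ := by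
  rw [← Matrix.conjTranspose_eq_transpose_of_trivial, Matrix.l2_opNorm_conjTranspose]

end EuclideanCLM

/-! ### Pseudoinverse and condition number -/

section Pinv

variable {m n r : ℕ}

theorem IsMoorePenrose.transpose {A : Matrix (Fin m) (Fin n) ℝ} {X : Matrix (Fin n) (Fin m) ℝ}
    (h : IsMoorePenrose A X) : IsMoorePenrose Aᵀ Xᵀ where
  mul_mul_self := by
    rw [← Matrix.transpose_mul, ← Matrix.transpose_mul, ← Matrix.mul_assoc, h.mul_mul_self]
  self_mul_mul := by
    rw [← Matrix.transpose_mul, ← Matrix.transpose_mul, ← Matrix.mul_assoc, h.self_mul_mul]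
  symm_left := by rw [← Matrix.transpose_mul, h.symm_right, h.symm_right]
  symm_right := by rw [← Matrix.transpose_mul, h.symm_left, h.symm_left]

theorem pinv_transpose (A : Matrix (Fin m) (Fin n) ℝ) : pinv Aᵀ = (pinv A)ᵀ :=
  (pinv_spec Aᵀ).unique (pinv_spec A).transpose

theorem cond2_transpose (A : Matrix (Fin m) (Fin n) ℝ) : cond2 Aᵀ = cond2 A := by
  rw [cond2, cond2, pinv_transpose, norm_transpose, norm_transpose]

/-- Left invertibility is an open condition, and a left inverse forces `X⁺ X = 1`. -/
theorem eventually_pinv_mul_self {A : Matrix (Fin m) (Fin n) ℝ} (hA : pinv A * A = 1) :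
    ∀ᶠ X in 𝓝 A, pinv X * X = 1 := by
  have hc : ContinuousAt (fun X : Matrix (Fin m) (Fin n) ℝ => (pinv A * X).det) A := by
    fun_prop
  have h0 : (pinv A * A).det ≠ 0 := by rw [hA, Matrix.det_one]; exact one_ne_zero
  filter_upwards [hc.eventually_ne h0] with X hX
  have hinv : (pinv A * X)⁻¹ * (pinv A * X) = 1 :=
    Matrix.nonsing_inv_mul _ (isUnit_iff_ne_zero.2 hX)
  calc pinv X * X = (pinv A * X)⁻¹ * (pinv A * X) * (pinv X * X) := by rw [hinv, Matrix.one_mul]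
    _ = (pinv A * X)⁻¹ * (pinv A * (X * pinv X * X)) := by simp only [Matrix.mul_assoc]
    _ = 1 := by rw [(pinv_spec X).mul_mul_self, hinv]

theorem inv_norm_apply_le_norm_pinv {X : Matrix (Fin m) (Fin n) ℝ} (hX : pinv X * X = 1)
    {x : EuclideanSpace ℝ (Fin n)} (hx : ‖x‖ = 1) : ‖euclideanCLM m n X x‖⁻¹ ≤ ‖pinv X‖ := by
  have h1 : euclideanCLM n m (pinv X) (euclideanCLM m n X x) = x := by
    rw [← euclideanCLM_mul_apply, hX]
    simp [euclideanCLM_apply]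
  have h2 := (euclideanCLM n m (pinv X)).le_opNorm (euclideanCLM m n X x)
  rw [h1, hx, norm_euclideanCLM] at h2
  have h3 : 0 < ‖euclideanCLM m n X x‖ := by
    rcases (norm_nonneg (euclideanCLM m n X x)).eq_or_lt with h | h
    · rw [← h, mul_zero] at h2
      exact absurd h2 (by norm_num)
    · exact h
  rw [inv_le_iff_one_le_mul₀ h3]
  exact h2

/-- A lower bound on `‖X x‖` over unit vectors bounds the pseudoinverse, since `X X⁺` is an
orthogonal projection. -/
theorem norm_pinv_le {X : Matrix (Fin m) (Fin n) ℝ} {q : ℝ} (hq : 0 < q)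
    (h : ∀ x, q * ‖x‖ ^ 2 ≤ ‖euclideanCLM m n X x‖ ^ 2) : ‖pinv X‖ ≤ (√q)⁻¹ := by
  rw [← norm_euclideanCLM]
  refine ContinuousLinearMap.opNorm_le_bound _ (by positivity) fun y => ?_
  set P := X * pinv X with hP
  have hPP : Pᵀ * P = P := by
    rw [hP, (pinv_spec X).symm_left, ← Matrix.mul_assoc, (pinv_spec X).mul_mul_self]
  have hPy : ‖euclideanCLM m m P y‖ ≤ ‖y‖ := by
    have h1 : ‖euclideanCLM m m P y‖ ^ 2 = ⟪y, euclideanCLM m m P y⟫ := by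
      rw [euclideanCLM_apply, norm_toLp_sq, Matrix.dotProduct_mulVec, ← Matrix.mulVec_transpose,
        Matrix.mulVec_mulVec, hPP, dotProduct_comm, ← inner_toLp]
    have h2 := (le_abs_self _).trans (abs_real_inner_le_norm y (euclideanCLM m m P y))
    rw [← h1, sq] at h2
    rcases (norm_nonneg (euclideanCLM m m P y)).eq_or_lt with h | h
    · rw [← h]; exact norm_nonneg _
    · exact le_of_mul_le_mul_right h2 h
  have h3 := h (euclideanCLM n m (pinv X) y)
  rw [← euclideanCLM_mul_apply, ← hP] at h3
  have h4 : √q * ‖euclideanCLM n m (pinv X) y‖ ≤ ‖y‖ := by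
    refine le_trans ?_ hPy
    refine (sq_le_sq₀ (by positivity) (norm_nonneg _)).1 ?_
    rw [mul_pow, Real.sq_sqrt hq.le]
    exact h3
  rw [inv_mul_eq_div, le_div_iff₀' (Real.sqrt_pos.2 hq)]
  exact h4

theorem norm_le_sqrt {X : Matrix (Fin m) (Fin n) ℝ} {p : ℝ} (hp : 0 ≤ p)
    (h : ∀ x, ‖euclideanCLM m n X x‖ ^ 2 ≤ p * ‖x‖ ^ 2) : ‖X‖ ≤ √p := by
  rw [← norm_euclideanCLM]
  refine ContinuousLinearMap.opNorm_le_bound _ (Real.sqrt_nonneg _) fun x => ?_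
  refine (sq_le_sq₀ (norm_nonneg _) (by positivity)).1 ?_
  rw [mul_pow, Real.sq_sqrt hp]
  exact h x

end Pinv

/-! ### Singular value decompositions -/

section SVD

variable {m n r : ℕ} {A : Matrix (Fin m) (Fin n) ℝ} {U : Matrix (Fin m) (Fin r) ℝ}
  {σ : Fin r → ℝ} {V : Matrix (Fin n) (Fin r) ℝ}

theorem IsThinSVD.transpose (h : IsThinSVD A U σ V) : IsThinSVD Aᵀ V σ U where
  orthU := h.orthV
  orthV := h.orthU
  nonneg := h.nonneg
  eq := by rw [h.eq]; simp [Matrix.mul_assoc]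

theorem norm_mul_diagonal_mul_transpose (hU : Uᵀ * U = 1) (hV : Vᵀ * V = 1) (s : Fin r → ℝ) :
    ‖U * Matrix.diagonal s * Vᵀ‖ = ‖s‖ := by
  have hle : ∀ {k : ℕ} {W : Matrix (Fin k) (Fin r) ℝ}, Wᵀ * W = 1 → ‖W‖ ≤ 1 := by
    intro k W hW
    have h1 := Matrix.l2_opNorm_conjTranspose_mul_self W
    rw [Matrix.conjTranspose_eq_transpose_of_trivial, hW, ← Matrix.diagonal_one,
      Matrix.l2_opNorm_diagonal] at h1
    have h2 : ‖(fun _ : Fin r => (1 : ℝ))‖ ≤ 1 := by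
      rw [pi_norm_le_iff_of_nonneg zero_le_one]; simp
    rw [h1] at h2
    nlinarith [norm_nonneg W]
  have bound : ∀ {a b c d : ℕ} (X : Matrix (Fin a) (Fin b) ℝ) (Y : Matrix (Fin b) (Fin c) ℝ)
      (Z : Matrix (Fin c) (Fin d) ℝ), ‖X‖ ≤ 1 → ‖Z‖ ≤ 1 → ‖X * Y * Z‖ ≤ ‖Y‖ := by
    intro a b c d X Y Z hX hZ
    calc ‖X * Y * Z‖ ≤ ‖X‖ * ‖Y‖ * ‖Z‖ :=
          (Matrix.l2_opNorm_mul _ _).trans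
            (mul_le_mul_of_nonneg_right (Matrix.l2_opNorm_mul _ _) (norm_nonneg _))
      _ ≤ 1 * ‖Y‖ * 1 := by gcongr
      _ = ‖Y‖ := by ring
  rw [← Matrix.l2_opNorm_diagonal s]
  refine le_antisymm (bound _ _ _ (hle hU) ((norm_transpose V).trans_le (hle hV))) ?_
  have e : Matrix.diagonal s = Uᵀ * (U * Matrix.diagonal s * Vᵀ) * V := by
    calc Matrix.diagonal s = (Uᵀ * U) * Matrix.diagonal s * (Vᵀ * V) := by
          rw [hU, hV, Matrix.one_mul, Matrix.mul_one]
      _ = _ := by simp only [Matrix.mul_assoc]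
  conv_lhs => rw [e]
  exact bound _ _ _ ((norm_transpose U).trans_le (hle hU)) (hle hV)

theorem IsThinSVD.mul_inverse_formula (h : IsThinSVD A U σ V) (hσ : ∀ i, 0 < σ i) :
    A * (V * Matrix.diagonal (fun i => (σ i)⁻¹) * Uᵀ) = U * Uᵀ := by
  have e : Matrix.diagonal σ * Matrix.diagonal (fun i => (σ i)⁻¹) = 1 := by
    rw [Matrix.diagonal_mul_diagonal, ← Matrix.diagonal_one]
    congr 1
    funext i
    exact mul_inv_cancel₀ (hσ i).ne'
  rw [h.eq]
  calc U * Matrix.diagonal σ * Vᵀ * (V * Matrix.diagonal (fun i => (σ i)⁻¹) * Uᵀ)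
      = U * (Matrix.diagonal σ * (Vᵀ * V) * Matrix.diagonal (fun i => (σ i)⁻¹)) * Uᵀ := by
        simp only [Matrix.mul_assoc]
    _ = U * Uᵀ := by rw [h.orthV, Matrix.mul_one, e, Matrix.mul_one]

theorem IsThinSVD.inverse_formula_mul (h : IsThinSVD A U σ V) (hσ : ∀ i, 0 < σ i) :
    (V * Matrix.diagonal (fun i => (σ i)⁻¹) * Uᵀ) * A = V * Vᵀ := by
  have := congrArg Matrix.transpose (h.transpose.mul_inverse_formula hσ)
  simpa [Matrix.transpose_mul, Matrix.mul_assoc] using this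

theorem IsThinSVD.pinv_eq (h : IsThinSVD A U σ V) (hσ : ∀ i, 0 < σ i) :
    pinv A = V * Matrix.diagonal (fun i => (σ i)⁻¹) * Uᵀ := by
  refine (pinv_spec A).unique ⟨?_, ?_, ?_, ?_⟩
  · rw [h.mul_inverse_formula hσ, h.eq]
    simp only [← Matrix.mul_assoc]
    rw [Matrix.mul_assoc U Uᵀ U, h.orthU, Matrix.mul_one]
  · rw [h.inverse_formula_mul hσ]
    simp only [← Matrix.mul_assoc]
    rw [Matrix.mul_assoc V Vᵀ V, h.orthV, Matrix.mul_one]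
  · rw [h.mul_inverse_formula hσ, Matrix.transpose_mul, Matrix.transpose_transpose]
  · rw [h.inverse_formula_mul hσ, Matrix.transpose_mul, Matrix.transpose_transpose]

theorem IsThinSVD.mul_pinv (h : IsThinSVD A U σ V) (hσ : ∀ i, 0 < σ i) : A * pinv A = U * Uᵀ := by
  rw [h.pinv_eq hσ, h.mul_inverse_formula hσ]

theorem IsThinSVD.pinv_mul (h : IsThinSVD A U σ V) (hσ : ∀ i, 0 < σ i) : pinv A * A = V * Vᵀ := by
  rw [h.pinv_eq hσ, h.inverse_formula_mul hσ]

theorem IsThinSVD.norm_eq (h : IsThinSVD A U σ V) {i : Fin r} (hi : ∀ j, σ j ≤ σ i) :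
    ‖A‖ = σ i := by
  rw [h.eq, norm_mul_diagonal_mul_transpose h.orthU h.orthV]
  refine le_antisymm ((pi_norm_le_iff_of_nonneg (h.nonneg i)).2 fun j => ?_) ?_
  · rw [Real.norm_of_nonneg (h.nonneg j)]; exact hi j
  · exact (le_abs_self _).trans (norm_le_pi_norm σ i)

theorem IsThinSVD.norm_pinv_eq (h : IsThinSVD A U σ V) {i : Fin r} (hpos : 0 < σ i)
    (hi : ∀ j, σ i ≤ σ j) : ‖pinv A‖ = (σ i)⁻¹ := by
  rw [h.pinv_eq fun j => hpos.trans_le (hi j), norm_mul_diagonal_mul_transpose h.orthV h.orthU]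
  refine le_antisymm ((pi_norm_le_iff_of_nonneg (by positivity)).2 fun j => ?_) ?_
  · have hj := hpos.trans_le (hi j)
    rw [Real.norm_of_nonneg (by positivity)]
    exact inv_anti₀ hpos (hi j)
  · exact (le_abs_self _).trans (norm_le_pi_norm (fun j => (σ j)⁻¹) i)

theorem IsThinSVD.mulVec_single (h : IsThinSVD A U σ V) (i : Fin r) :
    A *ᵥ (V *ᵥ Pi.single i 1) = σ i • (U *ᵥ Pi.single i 1) := by
  rw [h.eq, Matrix.mulVec_mulVec, Matrix.mul_assoc _ Vᵀ V, h.orthV, Matrix.mul_one,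
    ← Matrix.mulVec_mulVec, ← Matrix.mulVec_smul]
  congr 1
  ext j
  rw [Matrix.mulVec_diagonal]
  rcases eq_or_ne j i with rfl | hj
  · simp
  · simp [hj]

theorem IsThinSVD.norm_apply_sq (h : IsThinSVD A U σ V) (x : EuclideanSpace ℝ (Fin n)) :
    ‖euclideanCLM m n A x‖ ^ 2 = ∑ i, σ i ^ 2 * (Vᵀ *ᵥ x.ofLp) i ^ 2 := by
  rw [euclideanCLM_apply, norm_toLp_sq, h.eq, ← Matrix.mulVec_mulVec, ← Matrix.mulVec_mulVec,
    dotProduct_mulVec_of_orth h.orthU]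
  refine Finset.sum_congr rfl fun i _ => ?_
  rw [Matrix.mulVec_diagonal]; ring

theorem norm_sq_eq_sum_of_orth (hV : V * Vᵀ = 1) (x : EuclideanSpace ℝ (Fin n)) :
    ‖x‖ ^ 2 = ∑ i, (Vᵀ *ᵥ x.ofLp) i ^ 2 := by
  have e : ‖x‖ ^ 2 = x.ofLp ⬝ᵥ x.ofLp := norm_toLp_sq x.ofLp
  rw [e, ← dotProduct_mulVec_of_orth (U := Vᵀ) (by rwa [Matrix.transpose_transpose])]
  exact Finset.sum_congr rfl fun i _ => (sq _).symm

theorem inner_toLp_mulVec_single (i : Fin r) (x : EuclideanSpace ℝ (Fin n)) :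
    ⟪WithLp.toLp 2 (V *ᵥ Pi.single i 1), x⟫ = (Vᵀ *ᵥ x.ofLp) i := by
  have e := inner_toLp (V *ᵥ Pi.single i 1) x.ofLp
  rw [dotProduct_comm, Matrix.dotProduct_mulVec, ← Matrix.mulVec_transpose,
    dotProduct_single, mul_one] at e
  exact e

theorem norm_toLp_mulVec_single (hV : Vᵀ * V = 1) (i : Fin r) :
    ‖(WithLp.toLp 2 (V *ᵥ Pi.single i 1) : EuclideanSpace ℝ (Fin n))‖ = 1 := by
  refine (sq_eq_sq₀ (norm_nonneg _) zero_le_one).1 ?_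
  rw [norm_toLp_sq, dotProduct_mulVec_of_orth hV]
  simp

theorem IsThinSVD.norm_apply_single (h : IsThinSVD A U σ V) (i : Fin r) :
    ‖euclideanCLM m n A (WithLp.toLp 2 (V *ᵥ Pi.single i 1))‖ = σ i := by
  rw [euclideanCLM_apply, h.mulVec_single, WithLp.toLp_smul, norm_smul,
    norm_toLp_mulVec_single h.orthU, mul_one, Real.norm_of_nonneg (h.nonneg i)]

end SVD

/-! ### Sub- and superderivatives of the condition number -/

section Gap

variable {r : ℕ}

theorem exists_gap {s : Fin r → ℝ} {k : Fin r} (h : ∀ i, i ≠ k → s i < s k) :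
    ∃ δ > 0, ∀ i, i ≠ k → δ ≤ s k - s i := by
  have h1 : ∀ i, ∀ᶠ δ in 𝓝[>] (0 : ℝ), i ≠ k → δ ≤ s k - s i := by
    intro i
    by_cases hi : i = k
    · exact Eventually.of_forall fun _ hik => absurd hi hik
    · filter_upwards [nhdsWithin_le_nhds (Iic_mem_nhds (sub_pos.2 (h i hi)))] with δ hδ _
      exact hδ
  obtain ⟨δ, hδ, hpos⟩ := ((eventually_all.2 h1).and self_mem_nhdsWithin).exists
  exact ⟨δ, hpos, hδ⟩

theorem sum_mul_sq_le_of_gap {s : Fin r → ℝ} {k : Fin r} {δ : ℝ}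
    (h : ∀ i, i ≠ k → δ ≤ s k - s i) (y : Fin r → ℝ) :
    ∑ i, s i * y i ^ 2 ≤ s k * ∑ i, y i ^ 2 - δ * (∑ i, y i ^ 2 - y k ^ 2) := by
  have e : y k ^ 2 = ∑ i, if i = k then y i ^ 2 else 0 := by simp
  rw [e, ← Finset.sum_sub_distrib, Finset.mul_sum, Finset.mul_sum, ← Finset.sum_sub_distrib]
  refine Finset.sum_le_sum fun i _ => ?_
  split_ifs with hi
  · rw [hi]; linarith
  · nlinarith [mul_le_mul_of_nonneg_right (h i hi) (sq_nonneg (y i))]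

end Gap

section Gradient

variable {m n r : ℕ} {A : Matrix (Fin m) (Fin n) ℝ} {U : Matrix (Fin m) (Fin r) ℝ}
  {σ : Fin r → ℝ} {V : Matrix (Fin n) (Fin r) ℝ}

/-- For singular values `σ i`, `σ j` and the corresponding singular vectors, the gradient
`uᵢ vᵢᵀ / σ j - (σ i / σ j ²) uⱼ vⱼᵀ` of the quotient `σ i / σ j`. -/
noncomputable def quotientGradient (U : Matrix (Fin m) (Fin r) ℝ) (σ : Fin r → ℝ)
    (V : Matrix (Fin n) (Fin r) ℝ) (i j : Fin r) : Matrix (Fin m) (Fin n) ℝ :=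
  (σ j)⁻¹ • (U * unitOuter i * Vᵀ) - (σ i / σ j ^ 2) • (U * unitOuter j * Vᵀ)

theorem unitOuter_transpose (i : Fin r) : (unitOuter i)ᵀ = unitOuter i :=
  Matrix.transpose_vecMulVec _ _

theorem quotientGradient_transpose (i j : Fin r) :
    (quotientGradient U σ V i j)ᵀ = quotientGradient V σ U i j := by
  simp [quotientGradient, Matrix.transpose_mul, unitOuter_transpose, Matrix.mul_assoc]

theorem diagonal_mul_unitOuter_mul_diagonal (s : Fin r → ℝ) (i : Fin r) :
    Matrix.diagonal s * unitOuter i * Matrix.diagonal s = (s i ^ 2) • unitOuter i := by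
  ext a b
  simp only [unitOuter, Matrix.mul_diagonal, Matrix.diagonal_mul, Matrix.vecMulVec_apply,
    Matrix.smul_apply, smul_eq_mul, Pi.single_apply]
  split_ifs with ha hb
  · rw [ha, hb]; ring
  all_goals ring

theorem trace_unitOuter_mul (i : Fin r) (H : Matrix (Fin m) (Fin n) ℝ) :
    ((U * unitOuter i * Vᵀ)ᵀ * H).trace = (U *ᵥ Pi.single i 1) ⬝ᵥ (H *ᵥ (V *ᵥ Pi.single i 1)) := by
  rw [unitOuter, Matrix.mul_vecMulVec, Matrix.vecMulVec_mul, Matrix.vecMul_transpose,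
    Matrix.transpose_vecMulVec, Matrix.vecMulVec_mul, Matrix.trace_vecMulVec,
    Matrix.dotProduct_mulVec, dotProduct_comm]

/-- The correction terms with the projections `1 - A⁺ A` and `1 - A A⁺` vanish, because the columns
of `U` and `V` span the ranges of `A` and `Aᵀ`. -/
theorem IsThinSVD.eq_quotientGradient (h : IsThinSVD A U σ V) {first last : Fin r}
    (hfirst : ∀ i, σ i ≤ σ first) (hlast : ∀ i, σ last ≤ σ i) (hpos : 0 < σ last)
    {B : Matrix (Fin n) (Fin m) ℝ} (hB : B = ‖pinv A‖ • (V * unitOuter first * Uᵀ))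
    {C : Matrix (Fin m) (Fin n) ℝ} (hC : C = ‖A‖ • (U * unitOuter last * Vᵀ)) :
    Bᵀ - (pinv A * C * pinv A)ᵀ + (pinv A)ᵀ * pinv A * C * (1 - pinv A * A)
      + (1 - A * pinv A) * C * pinv A * (pinv A)ᵀ = quotientGradient U σ V first last := by
  have hσ : ∀ i, 0 < σ i := fun i => hpos.trans_le (hlast i)
  have e1 : C * (1 - pinv A * A) = 0 := by
    rw [h.pinv_mul hσ, hC, Matrix.mul_sub, Matrix.mul_one, Matrix.smul_mul, Matrix.mul_assoc _ Vᵀ,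
      ← Matrix.mul_assoc Vᵀ V, h.orthV, Matrix.one_mul, sub_self]
  have e2 : (1 - A * pinv A) * C = 0 := by
    rw [h.mul_pinv hσ, hC, Matrix.sub_mul, Matrix.one_mul, Matrix.mul_smul, Matrix.mul_assoc U Uᵀ,
      Matrix.mul_assoc U, ← Matrix.mul_assoc Uᵀ U, h.orthU, Matrix.one_mul, sub_self]
  have e3 : pinv A * C * pinv A = (σ first / σ last ^ 2) • (V * unitOuter last * Uᵀ) := by
    set D := Matrix.diagonal fun i => (σ i)⁻¹ with hD
    rw [h.pinv_eq hσ, ← hD, hC, h.norm_eq hfirst]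
    calc V * D * Uᵀ * (σ first • (U * unitOuter last * Vᵀ)) * (V * D * Uᵀ)
        = σ first • (V * (D * (Uᵀ * U) * unitOuter last * (Vᵀ * V) * D) * Uᵀ) := by
          simp only [Matrix.mul_assoc, Matrix.smul_mul, Matrix.mul_smul]
      _ = _ := by
          rw [h.orthU, h.orthV, Matrix.mul_one, Matrix.mul_one, hD,
            diagonal_mul_unitOuter_mul_diagonal, Matrix.mul_smul, Matrix.smul_mul, smul_smul,
            inv_pow, div_eq_mul_inv]
  rw [Matrix.mul_assoc _ C (1 - pinv A * A), e1, e2, e3, hB, h.norm_pinv_eq hpos hlast,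
    quotientGradient]
  simp [Matrix.transpose_mul, unitOuter_transpose, Matrix.mul_assoc]

end Gradient

section Tall

variable {m n r : ℕ} {A : Matrix (Fin m) (Fin n) ℝ} {U : Matrix (Fin m) (Fin r) ℝ}
  {σ : Fin r → ℝ} {V : Matrix (Fin n) (Fin r) ℝ}

theorem IsThinSVD.hasFDerivAt_singularQuotient (h : IsThinSVD A U σ V) {i j : Fin r}
    (hi : 0 < σ i) (hj : 0 < σ j) (K : ℝ) :
    HasFDerivAt (fun X => singularQuotient (WithLp.toLp 2 (V *ᵥ Pi.single i 1))
        (WithLp.toLp 2 (V *ᵥ Pi.single j 1)) (euclideanCLM m n A) K (euclideanCLM m n X))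
      (traceDual (quotientGradient U σ V i j)) A := by
  have hne : ∀ {k}, 0 < σ k →
      euclideanCLM m n A (WithLp.toLp 2 (V *ᵥ Pi.single k 1)) ≠ 0 := by
    intro k hk
    rw [← norm_ne_zero_iff, h.norm_apply_single]
    exact hk.ne'
  have h1 := (_root_.hasFDerivAt_singularQuotient (hne hi) (hne hj) K).comp A
    (euclideanCLM m n).hasFDerivAt
  refine h1.congr_fderiv ?_
  ext H
  have hin : ∀ k, ⟪euclideanCLM m n A (WithLp.toLp 2 (V *ᵥ Pi.single k 1)),
      euclideanCLM m n H (WithLp.toLp 2 (V *ᵥ Pi.single k 1))⟫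
      = σ k * ((U * unitOuter k * Vᵀ)ᵀ * H).trace := by
    intro k
    rw [euclideanCLM_apply, euclideanCLM_apply, inner_toLp, h.mulVec_single, smul_dotProduct,
      smul_eq_mul, trace_unitOuter_mul]
  have hG : traceDual (quotientGradient U σ V i j) H
      = (σ j)⁻¹ * ((U * unitOuter i * Vᵀ)ᵀ * H).trace
        - σ i / σ j ^ 2 * ((U * unitOuter j * Vᵀ)ᵀ * H).trace := by
    change ((quotientGradient U σ V i j)ᵀ * H).trace = _
    rw [quotientGradient, Matrix.transpose_sub, Matrix.sub_mul, Matrix.trace_sub,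
      Matrix.transpose_smul, Matrix.transpose_smul, Matrix.smul_mul, Matrix.smul_mul,
      Matrix.trace_smul, Matrix.trace_smul, smul_eq_mul, smul_eq_mul]
  rw [hG]
  simp only [ContinuousLinearMap.comp_apply, sub_apply, smul_apply, innerSL_apply_apply,
    ContinuousLinearMap.apply_apply, hin, h.norm_apply_single, smul_eq_mul]
  have := hi.ne'
  have := hj.ne'
  field_simp

theorem IsThinSVD.singularQuotient_self (h : IsThinSVD A U σ V) {i j : Fin r}
    (hi : ∀ k, σ k ≤ σ i) (hj : ∀ k, σ j ≤ σ k) (hpos : 0 < σ j) (K : ℝ) :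
    singularQuotient (WithLp.toLp 2 (V *ᵥ Pi.single i 1))
      (WithLp.toLp 2 (V *ᵥ Pi.single j 1)) (euclideanCLM m n A) K (euclideanCLM m n A)
      = cond2 A := by
  rw [singularQuotient, h.norm_apply_single, h.norm_apply_single, cond2, h.norm_eq hi,
    h.norm_pinv_eq hpos hj]
  simp [Real.sqrt_sq (h.nonneg _), div_eq_inv_mul]

/-- For a matrix of full column rank, plugging the extreme singular vectors of `A` into the
variational bounds for `‖X‖` and `‖X⁺‖` gives a minorant of the condition number. -/
theorem IsThinSVD.hasSubderivAt_of_tall (h : IsThinSVD A U σ V) (hV : V * Vᵀ = 1)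
    {first last : Fin r} (hfirst : ∀ i, σ i ≤ σ first) (hlast : ∀ i, σ last ≤ σ i)
    (hpos : 0 < σ last) :
    HasSubderivAt cond2 (traceDual (quotientGradient U σ V first last)) A := by
  have hσ : ∀ i, 0 < σ i := fun i => hpos.trans_le (hlast i)
  refine ⟨_, h.hasFDerivAt_singularQuotient (hσ first) hpos 0,
    h.singularQuotient_self hfirst hlast hpos 0, ?_⟩
  filter_upwards [eventually_pinv_mul_self (by rw [h.pinv_mul hσ, hV])] with X hX
  simp only [singularQuotient, zero_mul, add_zero, sub_zero]
  rw [Real.sqrt_sq (norm_nonneg _), Real.sqrt_sq (norm_nonneg _), div_eq_inv_mul, cond2]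
  refine mul_le_mul (inv_norm_apply_le_norm_pinv hX (norm_toLp_mulVec_single h.orthV _)) ?_
    (norm_nonneg _) (norm_nonneg _)
  have := (euclideanCLM m n X).le_opNorm (WithLp.toLp 2 (V *ᵥ Pi.single first 1))
  rwa [norm_toLp_mulVec_single h.orthV, mul_one, norm_euclideanCLM] at this

/-- For a matrix of full column rank with simple extreme singular values, the spectral gaps absorb
the cross terms in the perturbation of `‖X x‖²`, which gives a majorant of the condition number. -/
theorem IsThinSVD.hasSuperderivAt_of_tall (h : IsThinSVD A U σ V) (hV : V * Vᵀ = 1)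
    {first last : Fin r} (hfirst : ∀ i, i ≠ first → σ i < σ first)
    (hlast : ∀ i, i ≠ last → σ last < σ i) (hpos : 0 < σ last) :
    HasSuperderivAt cond2 (traceDual (quotientGradient U σ V first last)) A := by
  have hfirst' : ∀ i, σ i ≤ σ first := fun i => by
    rcases eq_or_ne i first with rfl | hi
    · exact le_rfl
    · exact (hfirst i hi).le
  have hlast' : ∀ i, σ last ≤ σ i := fun i => by
    rcases eq_or_ne i last with rfl | hi
    · exact le_rfl
    · exact (hlast i hi).le
  obtain ⟨δ₁, hδ₁, hgap₁⟩ := exists_gap (s := fun i => σ i ^ 2) (k := first)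
    fun i hi => pow_lt_pow_left₀ (hfirst i hi) (h.nonneg i) two_ne_zero
  obtain ⟨δ₂, hδ₂, hgap₂⟩ := exists_gap (s := fun i => -σ i ^ 2) (k := last)
    fun i hi => neg_lt_neg (pow_lt_pow_left₀ (hlast i hi) (h.nonneg last) two_ne_zero)
  set δ := min δ₁ δ₂
  have hδ : 0 < δ := lt_min hδ₁ hδ₂
  set w : EuclideanSpace ℝ (Fin n) := WithLp.toLp 2 (V *ᵥ Pi.single last 1) with hw
  set 𝒜 := euclideanCLM m n A with h𝒜
  have hq : ∀ᶠ X in 𝓝 A, 0 < ‖euclideanCLM m n X w‖ ^ 2 -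
      4 / δ * ((‖euclideanCLM m n X‖ + ‖𝒜‖) * ‖euclideanCLM m n X - 𝒜‖) ^ 2 := by
    have hc : Continuous fun X => ‖euclideanCLM m n X w‖ ^ 2 -
        4 / δ * ((‖euclideanCLM m n X‖ + ‖𝒜‖) * ‖euclideanCLM m n X - 𝒜‖) ^ 2 := by
      fun_prop
    refine hc.continuousAt.eventually_const_lt ?_
    simp only [← h𝒜]
    rw [hw, h𝒜, h.norm_apply_single]
    simpa using pow_pos hpos 2
  refine ⟨_, h.hasFDerivAt_singularQuotient (hpos.trans_le (hlast' first)) hpos (4 / δ),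
    h.singularQuotient_self hfirst' hlast' hpos (4 / δ), ?_⟩
  filter_upwards [hq] with X hX
  rw [singularQuotient, div_eq_inv_mul, cond2]
  refine mul_le_mul (norm_pinv_le hX fun x => ?_) (norm_le_sqrt (by positivity) fun x => ?_)
    (norm_nonneg _) (by positivity)
  · have h1 := abs_norm_sq_sub_le 𝒜 (euclideanCLM m n X) (norm_toLp_mulVec_single h.orthV last)
      hδ x
    have h2 := sum_mul_sq_le_of_gap (s := fun i => -σ i ^ 2)
      (fun i hi => (min_le_right δ₁ δ₂).trans (hgap₂ i hi))
      (Vᵀ *ᵥ x.ofLp)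
    simp only [neg_mul, Finset.sum_neg_distrib] at h2
    rw [← norm_sq_eq_sum_of_orth hV, ← h.norm_apply_sq, ← inner_toLp_mulVec_single] at h2
    rw [h.norm_apply_single] at h1
    have h3 := (abs_le.1 h1).1
    linarith
  · have h1 := abs_norm_sq_sub_le 𝒜 (euclideanCLM m n X) (norm_toLp_mulVec_single h.orthV first)
      hδ x
    have h2 := sum_mul_sq_le_of_gap (s := fun i => σ i ^ 2)
      (fun i hi => (min_le_left δ₁ δ₂).trans (hgap₁ i hi))
      (Vᵀ *ᵥ x.ofLp)
    rw [← norm_sq_eq_sum_of_orth hV, ← h.norm_apply_sq, ← inner_toLp_mulVec_single] at h2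
    rw [h.norm_apply_single] at h1
    have h3 := (abs_le.1 h1).2
    linarith

end Tall

section General

variable {m n r : ℕ} {A : Matrix (Fin m) (Fin n) ℝ} {U : Matrix (Fin m) (Fin r) ℝ}
  {σ : Fin r → ℝ} {V : Matrix (Fin n) (Fin r) ℝ}

theorem hasFDerivAt_transpose (A : Matrix (Fin m) (Fin n) ℝ) :
    HasFDerivAt (fun X : Matrix (Fin m) (Fin n) ℝ => Xᵀ)
      (LinearMap.toContinuousLinearMap
        (Matrix.transposeLinearEquiv (Fin m) (Fin n) ℝ ℝ).toLinearMap) A :=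
  (LinearMap.toContinuousLinearMap
    (Matrix.transposeLinearEquiv (Fin m) (Fin n) ℝ ℝ).toLinearMap).hasFDerivAt

theorem traceDual_transpose_comp (G : Matrix (Fin m) (Fin n) ℝ) :
    (traceDual Gᵀ).comp (LinearMap.toContinuousLinearMap
      (Matrix.transposeLinearEquiv (Fin m) (Fin n) ℝ ℝ).toLinearMap) = traceDual G := by
  ext H
  change (Gᵀᵀ * Hᵀ).trace = (Gᵀ * H).trace
  rw [← Matrix.transpose_mul, Matrix.trace_transpose, Matrix.trace_mul_comm]

theorem IsThinSVD.orth_of_full_rank (h : IsThinSVD A U σ V) (hr : r = min m n) :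
    V * Vᵀ = 1 ∨ U * Uᵀ = 1 := by
  rcases le_total n m with hnm | hmn
  · obtain rfl : r = n := by omega
    exact Or.inl (mul_eq_one_comm.1 h.orthV)
  · obtain rfl : r = m := by omega
    exact Or.inr (mul_eq_one_comm.1 h.orthU)

theorem IsThinSVD.hasSubderivAt (h : IsThinSVD A U σ V) (hr : r = min m n)
    {first last : Fin r} (hfirst : ∀ i, σ i ≤ σ first) (hlast : ∀ i, σ last ≤ σ i)
    (hpos : 0 < σ last) :
    HasSubderivAt cond2 (traceDual (quotientGradient U σ V first last)) A := by
  rcases h.orth_of_full_rank hr with hV | hU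
  · exact h.hasSubderivAt_of_tall hV hfirst hlast hpos
  · have h1 := (h.transpose.hasSubderivAt_of_tall hU hfirst hlast hpos).comp_hasFDerivAt
      (hasFDerivAt_transpose A)
    rw [← quotientGradient_transpose, traceDual_transpose_comp] at h1
    simpa only [cond2_transpose] using h1

theorem IsThinSVD.hasSuperderivAt (h : IsThinSVD A U σ V) (hr : r = min m n)
    {first last : Fin r} (hfirst : ∀ i, i ≠ first → σ i < σ first)
    (hlast : ∀ i, i ≠ last → σ last < σ i) (hpos : 0 < σ last) :
    HasSuperderivAt cond2 (traceDual (quotientGradient U σ V first last)) A := by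
  rcases h.orth_of_full_rank hr with hV | hU
  · exact h.hasSuperderivAt_of_tall hV hfirst hlast hpos
  · have h1 := (h.transpose.hasSuperderivAt_of_tall hU hfirst hlast hpos).comp_hasFDerivAt
      (hasFDerivAt_transpose A)
    rw [← quotientGradient_transpose, traceDual_transpose_comp] at h1
    simpa only [cond2_transpose] using h1

end General

/-! ### The derivative of the condition number -/

theorem lemma2 {m n r : ℕ} (hr : r = min m n) (hr0 : 0 < r)
    (A : Matrix (Fin m) (Fin n) ℝ) (U : Matrix (Fin m) (Fin r) ℝ) (σ : Fin r → ℝ)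
    (V : Matrix (Fin n) (Fin r) ℝ) (hsvd : IsThinSVD A U σ V) (hσ : Antitone σ)
    (first last : Fin r) (hfirst : (first : ℕ) = 0) (hlast : (last : ℕ) = r - 1)
    (hpos : 0 < σ last)
    (B : Matrix (Fin n) (Fin m) ℝ) (hB : B = ‖pinv A‖ • (V * unitOuter first * Uᵀ))
    (C : Matrix (Fin m) (Fin n) ℝ) (hC : C = ‖A‖ • (U * unitOuter last * Vᵀ))
    (G : Matrix (Fin m) (Fin n) ℝ)
    (hG : G = Bᵀ - (pinv A * C * pinv A)ᵀ
      + (pinv A)ᵀ * pinv A * C * (1 - pinv A * A)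
      + (1 - A * pinv A) * C * pinv A * (pinv A)ᵀ) :
    -- the derivative with respect to the matrix exists when the extreme singular values are
    -- simple, and it is `G` whenever it exists
    (((∀ i, i ≠ first → σ i < σ first) ∧ (∀ i, i ≠ last → σ last < σ i)) ∨
        DifferentiableAt ℝ (cond2 (m := m) (n := n)) A →
      HasMatrixDerivAt cond2 G A) ∧
    -- the partial derivative with respect to the parameter `θ_{i,j}`
    (∀ (p q : ℕ) (M : Matrix (Fin p) (Fin q) ℝ → Matrix (Fin m) (Fin n) ℝ)
        (θ : Matrix (Fin p) (Fin q) ℝ) (i : Fin p) (j : Fin q) (D : Matrix (Fin m) (Fin n) ℝ),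
      M θ = A →
      HasLineDerivAt ℝ M D θ (Matrix.single i j 1) →
      (((∀ k, k ≠ first → σ k < σ first) ∧ (∀ k, k ≠ last → σ last < σ k)) ∨
        LineDifferentiableAt ℝ (fun η => cond2 (M η)) θ (Matrix.single i j 1)) →
      HasLineDerivAt ℝ (fun η => cond2 (M η)) (Gᵀ * D).trace θ (Matrix.single i j 1)) := by
  have hfirst' : ∀ i, σ i ≤ σ first := fun i => hσ (by rw [Fin.le_def]; omega)
  have hlast' : ∀ i, σ last ≤ σ i := fun i => hσ (by rw [Fin.le_def]; omega)
  have hGq : G = quotientGradient U σ V first last := by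
    rw [hG]
    exact hsvd.eq_quotientGradient hfirst' hlast' hpos hB hC
  have hsub := hsvd.hasSubderivAt hr hfirst' hlast' hpos
  rw [← hGq] at hsub
  have hsimple : ((∀ i, i ≠ first → σ i < σ first) ∧ (∀ i, i ≠ last → σ last < σ i)) →
      HasFDerivAt cond2 (traceDual G) A := by
    rintro ⟨h1, h2⟩
    have hsup := hsvd.hasSuperderivAt hr h1 h2 hpos
    rw [← hGq] at hsup
    exact hsub.hasFDerivAt_of_superderiv hsup
  refine ⟨fun h => h.elim hsimple hsub.hasFDerivAt, ?_⟩
  intro p q M θ i j D hM hD h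
  have hc : HasDerivAt (fun t : ℝ => M (θ + t • Matrix.single i j 1)) D 0 := hD
  have hc0 : M (θ + (0 : ℝ) • Matrix.single i j 1) = A := by rw [zero_smul, add_zero, hM]
  rcases h with h | h
  · have hκ := hsimple h
    rw [← hc0] at hκ
    exact hκ.comp_hasDerivAt (0 : ℝ) hc
  · rw [← hc0] at hsub
    have h1 := (HasSubderivAt.comp_hasFDerivAt
      (c := fun t : ℝ => M (θ + t • Matrix.single i j 1)) hsub hc.hasFDerivAt).hasFDerivAt h
    have h2 := h1.hasDerivAt
    -- the composite functional evaluated at `1` is `tr(Gᵀ D)`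
    refine h2.congr_deriv ?_
    simp [traceDual]
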